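/- **Proposition (Generic failure of the Bourgain condition).** Let $d\ge 3$. For $x,y\in\mathbb R^d$ put $$\mathcal D(x,y)=1+(x\cdot y)^2-|x|^2-|y|^2,\qquad \mathfrak D(c_0)=\{(x,y): |x|,|y|\le 1-c_0,\ \mathcal D(x,y)>c_0^2\}\quad(0<c_0<1).$$ For $(x,y)\in\mathfrak D(c_0)$ define $S_c(x,y)\in[0,\pi]$ by $\cos S_c(x,y)=x\cdot y+\sqrt{\mathcal D(x,y)}$, and put $$\Phi_{\mathcal H}(x,y)=\frac12\Big(S_c(x,y)+\frac{(|x|^2+|y|^2)\cos S_c(x,y)-2\,x\cdot y}{\sin S_c(x,y)}\Big)\quad (x\neq y),\qquad \mathbf b(x,y)=x-\cos(S_c(x,y))\,y .$$ For $(x_0,y_0)\in\mathfrak D(c_0)$ and $\rho>0$, the Lee–Ryu reduced phase is obtained by rescaling $\Phi_{\mathcal H}$ and freezing the last coordinate of $y$ at that of $y_0$: $$\phi(x,\xi)=\rho^{-1}\,\Phi_{\mathcal H}\big(x_0+\rho x,\;y_0+\rho(\xi,0)\big),\qquad (x,\xi)\in\mathbb R^d\times\mathbb R^{d-1}\ \text{near}\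 (0,0).$$ For a phase $\phi$ on an open subset of $\mathbb R^d\times\mathbb R^{d-1}$ let $G_0(x,\xi)=\partial^2_{x\xi_1}\phi(x,\xi)\wedge\dots\wedge\partial^2_{x\xi_{d-1}}\phi(x,\xi)\in\Lambda^{d-1}\mathbb R^d\cong\mathbb R^d$. The Carleson–Sjölin conditions at $(x,\xi)$ are: (H1) $\partial^2_{x\xi}\phi(x,\xi)$ has rank $d-1$; (H2$^+$) all $d-1$ eigenvalues of $\partial^2_{\zeta\zeta}\langle\partial_x\phi(x,\zeta),G_0(x,\xi)\rangle|_{\zeta=\xi}$ are nonzero and have the same sign. Bourgain's condition holds at $(x,\xi)$ if the matrix $\big((G_0\cdot\nabla_x)^2\partial^2_{\xi\xi}\phi\big)(x,\xi)$ is a scalar multiple of $\big((G_0\cdot\nabla_x)\partial^2_{\xi\xi}\phi\big)(x,\xi)$, where $G_0\cdot\nabla_x$ is the first-order differential operator in $x$ with variable coefficients $G_0(x,\xi)$, and $(G_0\cdot\nabla_x)^2$ is its composition with itself. There is a neighbourhood $U$ of the origin in $\mathbb R^d$ such that the following holds for all $0<c_0<1$, all $\rho>0$ and all $(x_0,y_0)\in\mathfrak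 D(c_0)$ with $x_0\in U$, $y_0\ne0$, $\mathbf b(x_0,y_0)\neq 0$ and $$\frac{\mathbf b(x_0,y_0)}{|\mathbf b(x_0,y_0)|}=\mathbf e_d .$$ The phase $\phi$ is smooth near $(0,0)$ and satisfies (H1) and (H2$^+$) there; and $\phi$ satisfies Bourgain's condition at $(0,0)$ if and only if there is $c\in\mathbb R$ with $x_0=c\,y_0$. -/

import Mathlib

open scoped ContDiff

noncomputable section

/-! ### Phase functions on `ℝ^(m+1) × ℝ^m`

A phase function is `φ : ℝ^(m+1) → ℝ^m → ℝ`, written `φ x ξ`. -/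

/-- The Hessian matrix `(∂_{ξ_i} ∂_{ξ_j} f)(ξ)`. -/
def hessianMatrix {m : ℕ} (f : EuclideanSpace ℝ (Fin m) → ℝ) (ξ : EuclideanSpace ℝ (Fin m)) :
    Matrix (Fin m) (Fin m) ℝ :=
  Matrix.of fun i j =>
    fderiv ℝ (fun ζ => fderiv ℝ f ζ (EuclideanSpace.single j 1)) ξ (EuclideanSpace.single i 1)

/-- The gradient `∂_x φ(x, ξ)` in the variable `x`. -/
def gradX {m : ℕ} (φ : EuclideanSpace ℝ (Fin (m + 1)) → EuclideanSpace ℝ (Fin m) → ℝ)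
    (x : EuclideanSpace ℝ (Fin (m + 1))) (ξ : EuclideanSpace ℝ (Fin m)) :
    EuclideanSpace ℝ (Fin (m + 1)) :=
  gradient (fun z => φ z ξ) x

/-- The vector `∂_{ξ_i} ∂_x φ(x, ξ) ∈ ℝ^(m+1)`. -/
def mixedDeriv {m : ℕ} (φ : EuclideanSpace ℝ (Fin (m + 1)) → EuclideanSpace ℝ (Fin m) → ℝ)
    (x : EuclideanSpace ℝ (Fin (m + 1))) (ξ : EuclideanSpace ℝ (Fin m)) (i : Fin m) :
    EuclideanSpace ℝ (Fin (m + 1)) :=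
  fderiv ℝ (fun ζ => gradX φ x ζ) ξ (EuclideanSpace.single i 1)

/-- The unnormalized Gauss map
`G₀(x, ξ) = ∂²_{x ξ_1} φ ∧ ⋯ ∧ ∂²_{x ξ_m} φ ∈ Λ^m ℝ^(m+1) ≅ ℝ^(m+1)`:
the vector with `⟨w, G₀⟩ = det (w, ∂²_{x ξ_1} φ, …, ∂²_{x ξ_m} φ)` for all `w`. -/
def gaussMap {m : ℕ} (φ : EuclideanSpace ℝ (Fin (m + 1)) → EuclideanSpace ℝ (Fin m) → ℝ)
    (x : EuclideanSpace ℝ (Fin (m + 1))) (ξ : EuclideanSpace ℝ (Fin m)) :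
    EuclideanSpace ℝ (Fin (m + 1)) :=
  WithLp.toLp 2 fun k =>
    Matrix.det (Matrix.of
      (Fin.cons (fun l => if l = k then (1 : ℝ) else 0) (fun i l => mixedDeriv φ x ξ i l) :
        Fin (m + 1) → Fin (m + 1) → ℝ))

/-- `H1`: the matrix `∂²_{x ξ} φ(x, ξ)` has maximal rank `m`. -/
def ConditionH1 {m : ℕ} (φ : EuclideanSpace ℝ (Fin (m + 1)) → EuclideanSpace ℝ (Fin m) → ℝ)
    (x : EuclideanSpace ℝ (Fin (m + 1))) (ξ : EuclideanSpace ℝ (Fin m)) : Prop :=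
  (Matrix.of fun (i : Fin m) (k : Fin (m + 1)) => mixedDeriv φ x ξ i k).rank = m

/-- The matrix `∂²_{ζζ} ⟨∂_x φ(x, ζ), G₀(x, ξ)⟩` at `ζ = ξ`. -/
def curvatureMatrix {m : ℕ} (φ : EuclideanSpace ℝ (Fin (m + 1)) → EuclideanSpace ℝ (Fin m) → ℝ)
    (x : EuclideanSpace ℝ (Fin (m + 1))) (ξ : EuclideanSpace ℝ (Fin m)) :
    Matrix (Fin m) (Fin m) ℝ :=
  hessianMatrix (fun ζ => inner ℝ (gradX φ x ζ) (gaussMap φ x ξ)) ξ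

/-- `H2⁺`: the `m` eigenvalues of the (symmetric) curvature matrix are nonzero and have the same
sign, i.e. the matrix is positive definite or negative definite. -/
def ConditionH2Plus {m : ℕ}
    (φ : EuclideanSpace ℝ (Fin (m + 1)) → EuclideanSpace ℝ (Fin m) → ℝ)
    (x : EuclideanSpace ℝ (Fin (m + 1))) (ξ : EuclideanSpace ℝ (Fin m)) : Prop :=
  (curvatureMatrix φ x ξ).PosDef ∨ (-(curvatureMatrix φ x ξ)).PosDef

/-- The phase is smooth near `(x, ξ)` and satisfies `H1` and `H2⁺` there. -/
structure CarlesonSjolinAt {m : ℕ}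
    (φ : EuclideanSpace ℝ (Fin (m + 1)) → EuclideanSpace ℝ (Fin m) → ℝ)
    (x : EuclideanSpace ℝ (Fin (m + 1))) (ξ : EuclideanSpace ℝ (Fin m)) : Prop where
  smooth : ContDiffAt ℝ ∞
    (fun p : EuclideanSpace ℝ (Fin (m + 1)) × EuclideanSpace ℝ (Fin m) => φ p.1 p.2) (x, ξ)
  h1 : ConditionH1 φ x ξ
  h2 : ConditionH2Plus φ x ξ

/-- The first-order operator `G₀(·, ξ) · ∇_x`, applied to a function `F` of `x` (for fixed `ξ`). -/
def gaussDeriv {m : ℕ} (φ : EuclideanSpace ℝ (Fin (m + 1)) → EuclideanSpace ℝ (Fin m) → ℝ)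
    (ξ : EuclideanSpace ℝ (Fin m)) (F : EuclideanSpace ℝ (Fin (m + 1)) → ℝ)
    (x : EuclideanSpace ℝ (Fin (m + 1))) : ℝ :=
  fderiv ℝ F x (gaussMap φ x ξ)

/-- The matrix `((G₀ · ∇_x)^k ∂²_{ξξ} φ)(x, ξ)`. -/
def gaussDerivHessian {m : ℕ} (k : ℕ)
    (φ : EuclideanSpace ℝ (Fin (m + 1)) → EuclideanSpace ℝ (Fin m) → ℝ)
    (x : EuclideanSpace ℝ (Fin (m + 1))) (ξ : EuclideanSpace ℝ (Fin m)) :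
    Matrix (Fin m) (Fin m) ℝ :=
  Matrix.of fun i j => (gaussDeriv φ ξ)^[k] (fun z => hessianMatrix (φ z) ξ i j) x

/-- Bourgain's condition at `(x, ξ)`: `(G₀ · ∇_x)² ∂²_{ξξ} φ` is a scalar multiple of
`(G₀ · ∇_x) ∂²_{ξξ} φ` at `(x, ξ)`. -/
def BourgainConditionAt {m : ℕ}
    (φ : EuclideanSpace ℝ (Fin (m + 1)) → EuclideanSpace ℝ (Fin m) → ℝ)
    (x : EuclideanSpace ℝ (Fin (m + 1))) (ξ : EuclideanSpace ℝ (Fin m)) : Prop :=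
  ∃ c : ℝ, gaussDerivHessian 2 φ x ξ = c • gaussDerivHessian 1 φ x ξ

/-! ### The Hermite phase -/

/-- `𝒟(x, y) = 1 + (x · y)² - |x|² - |y|²`. -/
def hermiteD {d : ℕ} (x y : EuclideanSpace ℝ (Fin d)) : ℝ :=
  1 + (inner ℝ x y) ^ 2 - ‖x‖ ^ 2 - ‖y‖ ^ 2

/-- `𝔇(c₀) = {(x, y) : |x|, |y| ≤ 1 - c₀, 𝒟(x, y) > c₀²}`. -/
def hermiteRegion (d : ℕ) (c₀ : ℝ) : Set (EuclideanSpace ℝ (Fin d) × EuclideanSpace ℝ (Fin d)) :=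
  {p | ‖p.1‖ ≤ 1 - c₀ ∧ ‖p.2‖ ≤ 1 - c₀ ∧ c₀ ^ 2 < hermiteD p.1 p.2}

/-- `S_c(x, y) ∈ [0, π]` with `cos S_c(x, y) = ⟨x, y⟩ + √𝒟(x, y)`. -/
def hermiteS {d : ℕ} (x y : EuclideanSpace ℝ (Fin d)) : ℝ :=
  Real.arccos (inner ℝ x y + √(hermiteD x y))

/-- `Φ(x, y) = (S_c + ((|x|² + |y|²) cos S_c - 2 x · y) / sin S_c) / 2`. -/
def hermitePhase {d : ℕ} (x y : EuclideanSpace ℝ (Fin d)) : ℝ :=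
  (1 / 2) * (hermiteS x y +
    ((‖x‖ ^ 2 + ‖y‖ ^ 2) * Real.cos (hermiteS x y) - 2 * inner ℝ x y) / Real.sin (hermiteS x y))

/-- `b(x, y) = x - cos(S_c(x, y)) y`. -/
def hermiteB {d : ℕ} (x y : EuclideanSpace ℝ (Fin d)) : EuclideanSpace ℝ (Fin d) :=
  x - Real.cos (hermiteS x y) • y

/-- The rescaled phase `ρ⁻¹ Φ(x₀ + ρ x, y₀ + ρ y)`. -/
def rescaledPhase {d : ℕ} (x₀ y₀ : EuclideanSpace ℝ (Fin d)) (ρ : ℝ)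
    (x y : EuclideanSpace ℝ (Fin d)) : ℝ :=
  ρ⁻¹ * hermitePhase (x₀ + ρ • x) (y₀ + ρ • y)

/-- The reduced phase `φ_{y_d}(x, ξ)`: the rescaled phase at `(x, y)` with `y = (ξ, y_d)`, the last
coordinate `y_d` being frozen. Here `d = m + 1`. -/
def reducedPhase {m : ℕ} (x₀ y₀ : EuclideanSpace ℝ (Fin (m + 1))) (ρ yd : ℝ)
    (x : EuclideanSpace ℝ (Fin (m + 1))) (ξ : EuclideanSpace ℝ (Fin m)) : ℝ :=
  rescaledPhase x₀ y₀ ρ x (WithLp.toLp 2 (Fin.snoc (α := fun _ => ℝ) (fun i => ξ i) yd))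

end

/-!
Write `c = cos S_c`, `s = sin S_c`, `p = (x - c y) / s` and `q = (c x - y) / s`. The Hermite phase is
the action of the harmonic oscillator at fixed energy: `S_c` is a critical point of
`t ↦ t / 2 + ((|x|² + |y|²) cos t - 2 x · y) / (2 sin t)`, so `∂_x Φ = q` and `∂_y Φ = -p`
(`HermiteRegular.hasDerivAt_hermitePhase`), with `|p|² + |y|² = 1`. Differentiating once more gives
`∂_y q = (-1 + p ⊗ q / ⟨p, q⟩) / s` and `∂²_{yy} Φ = (c / s) 1 - q qᵀ / (s ⟨p, q⟩)`, where
`⟨p, q⟩ = √𝒟`.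

The classical trajectory `γ(t) = cos t y₀ + sin t p` from `y₀` to `x₀` satisfies `S_c(γ(t), y₀) = t`
and keeps `p` fixed, and its velocity is `q` (`hermite_trajectory`). The hypothesis on `b = s p` says
that `p` is a positive multiple of the last basis vector. Then the mixed derivatives along `γ` are
orthogonal to `q`, so that `G₀` is a nonzero multiple of `γ'` (`reducedPhase_on_trajectory`), and
along `γ` the Hessian in `ξ` equals, up to the factor `ρ`,
`cot t 1 - (sin t / Δ(t)) y' y'ᵀ` with `Δ(t) = |p|² cos t - ⟨p, y₀⟩ sin t > 0`, where `y'` denotes the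
first `m` coordinates of `y₀`. Since `G₀ · ∇_x` acts along `γ` as `l(t) d/dt`
(`gaussDeriv_along_curve`), everything reduces to two derivatives of this matrix function.

The first derivative is `-(s⁻² 1 + |p|² Δ⁻² y' y'ᵀ)`, which is negative definite; as partial
derivatives commute it is, up to a nonzero factor, the curvature matrix of `H2⁺`
(`curvatureMatrix_eq_gaussDerivHessian`). Bourgain's condition says that the second derivative is
proportional to the first. Both are combinations of `1` and `y' y'ᵀ`, and the determinant of their
coefficients is a nonzero multiple of `|p|⁴`; since `m ≥ 2`, the matrices `1` and `y' y'ᵀ` are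
linearly independent unless `y' = 0`, so the condition holds iff `y' = 0`. This means that `y₀` is
parallel to `b`, equivalently that `x₀` is a multiple of `y₀`.
-/

open Filter Topology

noncomputable section

/-! ### Iterated directional derivatives of a phase -/

section PhaseCalculus

variable {V : Type*} [NormedAddCommGroup V] [NormedSpace ℝ V]

/-- The directional derivative `∂_u f`, as a function of the base point. Viewing a phase as a
function on the product space, all the mixed derivatives below are iterates of it. -/
def dirDeriv (u : V) (f : V → ℝ) (p : V) : ℝ := fderiv ℝ f p u

theorem ContDiffAt.dirDeriv {f : V → ℝ} {p : V} (hf : ContDiffAt ℝ ∞ f p) (u : V) :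
    ContDiffAt ℝ ∞ (dirDeriv u f) p :=
  (hf.fderiv_right (m := ∞) (by simp)).clm_apply contDiffAt_const

theorem eventually_contDiffAt_dirDeriv {f : V → ℝ} {p : V}
    (hf : ∀ᶠ q in 𝓝 p, ContDiffAt ℝ ∞ f q) (u : V) :
    ∀ᶠ q in 𝓝 p, ContDiffAt ℝ ∞ (dirDeriv u f) q :=
  hf.mono fun _ h => h.dirDeriv u

theorem dirDeriv_congr {f g : V → ℝ} {p : V} (h : f =ᶠ[𝓝 p] g) (u : V) :
    dirDeriv u f p = dirDeriv u g p := by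
  rw [dirDeriv, dirDeriv, h.fderiv_eq]

theorem dirDeriv_comm {f : V → ℝ} {p : V} (hf : ContDiffAt ℝ ∞ f p) (u v : V) :
    dirDeriv u (dirDeriv v f) p = dirDeriv v (dirDeriv u f) p := by
  have hd : DifferentiableAt ℝ (fderiv ℝ f) p :=
    (hf.fderiv_right (m := ∞) (by simp)).differentiableAt (by simp)
  have key : ∀ a b : V, dirDeriv a (dirDeriv b f) p = fderiv ℝ (fderiv ℝ f) p a b := by
    intro a b
    change fderiv ℝ (fun y => fderiv ℝ f y b) p a = _
    rw [fderiv_clm_apply hd (differentiableAt_const b)]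
    simp
  rw [key, key]
  exact hf.isSymmSndFDerivAt (by
    rw [minSmoothness_of_isRCLikeNormedField]
    exact WithTop.coe_le_coe.2 (le_top (a := (2 : ℕ∞)))) u v

/-- The directional derivative is the derivative along a curve with the right velocity. -/
theorem dirDeriv_eq_of_hasDerivAt {f : V → ℝ} {γ : ℝ → V} {t a : ℝ} {p u : V}
    (hp : γ t = p) (hf : DifferentiableAt ℝ f p) (hγ : HasDerivAt γ u t)
    (h : HasDerivAt (fun τ => f (γ τ)) a t) : dirDeriv u f p = a := by
  subst hp
  exact (hf.hasFDerivAt.comp_hasDerivAt t hγ).unique h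

end PhaseCalculus

section Phase

variable {m : ℕ} {φ : EuclideanSpace ℝ (Fin (m + 1)) → EuclideanSpace ℝ (Fin m) → ℝ}
  {x : EuclideanSpace ℝ (Fin (m + 1))} {ξ : EuclideanSpace ℝ (Fin m)}

local notation "𝔼" => EuclideanSpace ℝ (Fin (m + 1))
local notation "𝔽" => EuclideanSpace ℝ (Fin m)

theorem fderiv_snd_eq_dirDeriv {f : 𝔼 × 𝔽 → ℝ} (h : DifferentiableAt ℝ f (x, ξ)) (w : 𝔽) :
    fderiv ℝ (fun ζ => f (x, ζ)) ξ w = dirDeriv (0, w) f (x, ξ) := by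
  have h2 : HasFDerivAt (fun ζ : 𝔽 => f (x, ζ))
      ((fderiv ℝ f (x, ξ)).comp (ContinuousLinearMap.inr ℝ 𝔼 𝔽)) ξ :=
    h.hasFDerivAt.comp ξ (hasFDerivAt_prodMk_right x ξ)
  rw [h2.fderiv]; rfl

theorem fderiv_fst_eq_dirDeriv {f : 𝔼 × 𝔽 → ℝ} (h : DifferentiableAt ℝ f (x, ξ)) (u : 𝔼) :
    fderiv ℝ (fun z => f (z, ξ)) x u = dirDeriv (u, 0) f (x, ξ) := by
  have h2 : HasFDerivAt (fun z : 𝔼 => f (z, ξ))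
      ((fderiv ℝ f (x, ξ)).comp (ContinuousLinearMap.inl ℝ 𝔼 𝔽)) x :=
    h.hasFDerivAt.comp x (hasFDerivAt_prodMk_left x ξ)
  rw [h2.fderiv]; rfl

theorem eventually_snd {P : 𝔼 × 𝔽 → Prop} (h : ∀ᶠ p in 𝓝 (x, ξ), P p) :
    ∀ᶠ ζ in 𝓝 ξ, P (x, ζ) :=
  (Continuous.prodMk_right x).continuousAt.eventually h

theorem eventually_fst {P : 𝔼 × 𝔽 → Prop} (h : ∀ᶠ p in 𝓝 (x, ξ), P p) :
    ∀ᶠ z in 𝓝 x, P (z, ξ) :=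
  (Continuous.prodMk_left ξ).continuousAt.eventually h

theorem hessianMatrix_congr {f g : 𝔽 → ℝ} (h : f =ᶠ[𝓝 ξ] g) :
    hessianMatrix f ξ = hessianMatrix g ξ := by
  ext i j
  simp only [hessianMatrix, Matrix.of_apply]
  have h2 : (fun ζ => fderiv ℝ f ζ (EuclideanSpace.single j 1)) =ᶠ[𝓝 ξ]
      fun ζ => fderiv ℝ g ζ (EuclideanSpace.single j 1) :=
    h.eventually_nhds.mono fun ζ hζ => by
      simp only [Filter.EventuallyEq.fderiv_eq hζ]
  rw [h2.fderiv_eq]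

theorem hessianMatrix_eq_dirDeriv {f : 𝔼 × 𝔽 → ℝ}
    (h : ∀ᶠ p in 𝓝 (x, ξ), ContDiffAt ℝ ∞ f p) (i j : Fin m) :
    hessianMatrix (fun ζ => f (x, ζ)) ξ i j =
      dirDeriv (0, EuclideanSpace.single i 1) (dirDeriv (0, EuclideanSpace.single j 1) f)
        (x, ξ) := by
  simp only [hessianMatrix, Matrix.of_apply]
  have h2 : (fun ζ => fderiv ℝ (fun ζ => f (x, ζ)) ζ (EuclideanSpace.single j 1)) =ᶠ[𝓝 ξ]
      fun ζ => dirDeriv (0, EuclideanSpace.single j 1) f (x, ζ) :=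
    (eventually_snd h).mono fun ζ hζ =>
      fderiv_snd_eq_dirDeriv (hζ.differentiableAt (by simp)) _
  rw [h2.fderiv_eq]
  exact fderiv_snd_eq_dirDeriv ((h.self_of_nhds.dirDeriv _).differentiableAt (by simp)) _

theorem inner_gradX (h : ContDiffAt ℝ ∞ (fun p : 𝔼 × 𝔽 => φ p.1 p.2) (x, ξ)) (u : 𝔼) :
    inner ℝ (gradX φ x ξ) u = dirDeriv (u, 0) (fun p : 𝔼 × 𝔽 => φ p.1 p.2) (x, ξ) := by
  rw [gradX, inner_gradient_left]
  exact fderiv_fst_eq_dirDeriv (f := fun p : 𝔼 × 𝔽 => φ p.1 p.2)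
    (h.differentiableAt (by simp)) u

theorem mixedDeriv_eq_dirDeriv (h : ∀ᶠ p in 𝓝 (x, ξ), ContDiffAt ℝ ∞
    (fun p : 𝔼 × 𝔽 => φ p.1 p.2) p) (i : Fin m) (k : Fin (m + 1)) :
    mixedDeriv φ x ξ i k =
      dirDeriv (0, EuclideanSpace.single i 1) (dirDeriv (EuclideanSpace.single k 1, 0)
        (fun p : 𝔼 × 𝔽 => φ p.1 p.2)) (x, ξ) := by
  have hk : ∀ k : Fin (m + 1), (fun ζ => gradX φ x ζ k) =ᶠ[𝓝 ξ]
      fun ζ => dirDeriv (EuclideanSpace.single k 1, 0) (fun p : 𝔼 × 𝔽 => φ p.1 p.2) (x, ζ) := by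
    intro k
    refine (eventually_snd h).mono fun ζ hζ => ?_
    simp only [← inner_gradX hζ, EuclideanSpace.inner_single_right]
    simp
  have hdiff : ∀ k : Fin (m + 1), DifferentiableAt ℝ
      (dirDeriv (EuclideanSpace.single k 1, 0) (fun p : 𝔼 × 𝔽 => φ p.1 p.2)) (x, ξ) := fun k =>
    (h.self_of_nhds.dirDeriv _).differentiableAt (by simp)
  have hg : DifferentiableAt ℝ (fun ζ => gradX φ x ζ) ξ := by
    rw [differentiableAt_euclidean]
    intro k
    refine DifferentiableAt.congr_of_eventuallyEq ?_ (hk k)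
    exact (hdiff k).comp ξ (hasFDerivAt_prodMk_right x ξ).differentiableAt
  have h3 : HasFDerivAt (fun ζ => gradX φ x ζ k)
      ((EuclideanSpace.proj k : 𝔼 →L[ℝ] ℝ).comp (fderiv ℝ (fun ζ => gradX φ x ζ) ξ)) ξ :=
    (EuclideanSpace.proj k : 𝔼 →L[ℝ] ℝ).hasFDerivAt.comp ξ hg.hasFDerivAt
  have h4 : mixedDeriv φ x ξ i k =
      fderiv ℝ (fun ζ => gradX φ x ζ k) ξ (EuclideanSpace.single i 1) := by
    rw [h3.fderiv]; rfl
  rw [h4, (hk k).fderiv_eq]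
  exact fderiv_snd_eq_dirDeriv (hdiff k) _

theorem contDiffAt_gaussMap (h : ∀ᶠ p in 𝓝 (x, ξ), ContDiffAt ℝ ∞
    (fun p : 𝔼 × 𝔽 => φ p.1 p.2) p) : ContDiffAt ℝ ∞ (fun z => gaussMap φ z ξ) x := by
  have hm : ∀ i k, ContDiffAt ℝ ∞ (fun z => mixedDeriv φ z ξ i k) x := by
    intro i k
    have h1 : (fun z => mixedDeriv φ z ξ i k) =ᶠ[𝓝 x] fun z =>
        dirDeriv (0, EuclideanSpace.single i 1) (dirDeriv (EuclideanSpace.single k 1, 0)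
          (fun p : 𝔼 × 𝔽 => φ p.1 p.2)) (z, ξ) :=
      (eventually_fst h.eventually_nhds).mono fun z hz => mixedDeriv_eq_dirDeriv hz i k
    refine ContDiffAt.congr_of_eventuallyEq ?_ h1
    exact ((h.self_of_nhds.dirDeriv _).dirDeriv _).comp x
      (contDiffAt_id.prodMk contDiffAt_const)
  rw [contDiffAt_euclidean]
  intro k
  simp only [gaussMap, Matrix.det_apply]
  refine ContDiffAt.sum fun σ _ => ContDiffAt.const_smul _ ?_
  refine contDiffAt_prod fun i _ => ?_
  simp only [Matrix.of_apply]
  refine Fin.cases ?_ (fun j => ?_) (σ i)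
  · simp only [Fin.cons_zero]; exact contDiffAt_const
  · simp only [Fin.cons_succ]; exact hm _ _

theorem contDiffAt_hessianMatrix (h : ∀ᶠ p in 𝓝 (x, ξ), ContDiffAt ℝ ∞
    (fun p : 𝔼 × 𝔽 => φ p.1 p.2) p) (i j : Fin m) :
    ContDiffAt ℝ ∞ (fun z => hessianMatrix (φ z) ξ i j) x := by
  refine ContDiffAt.congr_of_eventuallyEq ?_ ((eventually_fst h.eventually_nhds).mono
    fun z hz => hessianMatrix_eq_dirDeriv hz i j)
  exact ((h.self_of_nhds.dirDeriv _).dirDeriv _).comp x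
    (contDiffAt_id.prodMk contDiffAt_const)

/-- Since partial derivatives commute, the curvature matrix of `H2⁺` is the matrix
`(G₀ · ∇_x) ∂²_{ξξ} φ` of Bourgain's condition. -/
theorem curvatureMatrix_eq_gaussDerivHessian (h : ∀ᶠ p in 𝓝 (x, ξ), ContDiffAt ℝ ∞
    (fun p : 𝔼 × 𝔽 => φ p.1 p.2) p) :
    curvatureMatrix φ x ξ = gaussDerivHessian 1 φ x ξ := by
  ext i j
  set G := gaussMap φ x ξ with hG
  set Ψ : 𝔼 × 𝔽 → ℝ := fun p => φ p.1 p.2 with hΨ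
  have h1 : curvatureMatrix φ x ξ = hessianMatrix (fun ζ => dirDeriv (G, 0) Ψ (x, ζ)) ξ :=
    hessianMatrix_congr ((eventually_snd h).mono fun ζ hζ => inner_gradX hζ G)
  have h2 : (fun z => hessianMatrix (φ z) ξ i j) =ᶠ[𝓝 x] fun z =>
      dirDeriv (0, EuclideanSpace.single i 1) (dirDeriv (0, EuclideanSpace.single j 1) Ψ)
        (z, ξ) :=
    (eventually_fst h.eventually_nhds).mono fun z hz => hessianMatrix_eq_dirDeriv hz i j
  have h3 : gaussDerivHessian 1 φ x ξ i j = dirDeriv (G, 0) (dirDeriv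
      (0, EuclideanSpace.single i 1) (dirDeriv (0, EuclideanSpace.single j 1) Ψ)) (x, ξ) := by
    simp only [gaussDerivHessian, Matrix.of_apply, Function.iterate_one, gaussDeriv]
    rw [h2.fderiv_eq]
    exact fderiv_fst_eq_dirDeriv
      (((h.self_of_nhds.dirDeriv _).dirDeriv _).differentiableAt (by simp)) _
  rw [h1, hessianMatrix_eq_dirDeriv (eventually_contDiffAt_dirDeriv h _), h3,
    dirDeriv_comm (h.self_of_nhds.dirDeriv _) (G, 0)]
  exact dirDeriv_congr (h.mono fun p hp => dirDeriv_comm hp _ _) _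

/-- If `G₀` is tangent to a curve `z(t)`, say `G₀(z(t), ξ) = l(t) z'(t)`, then `G₀ · ∇_x` acts on
functions along the curve as `l(t) d/dt`, so `(G₀ · ∇_x) F` and `(G₀ · ∇_x)² F` are determined by
the restriction `k` of `F` to the curve. -/
theorem gaussDeriv_along_curve {F : 𝔼 → ℝ} {z : ℝ → 𝔼} {z' : ℝ → 𝔼} {l k k' : ℝ → ℝ}
    {t₀ k'' : ℝ} (hz₀ : z t₀ = x)
    (hF : ContDiffAt ℝ ∞ F x) (hG : ContDiffAt ℝ ∞ (fun z => gaussMap φ z ξ) x)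
    (hz : ∀ᶠ t in 𝓝 t₀, HasDerivAt z (z' t) t)
    (hl : ∀ᶠ t in 𝓝 t₀, gaussMap φ (z t) ξ = l t • z' t) (hl' : DifferentiableAt ℝ l t₀)
    (hk : ∀ᶠ t in 𝓝 t₀, F (z t) = k t) (hk' : ∀ᶠ t in 𝓝 t₀, HasDerivAt k (k' t) t)
    (hk'' : HasDerivAt k' k'' t₀) :
    (gaussDeriv φ ξ)^[1] F x = l t₀ * k' t₀ ∧
    (gaussDeriv φ ξ)^[2] F x = l t₀ ^ 2 * k'' + l t₀ * deriv l t₀ * k' t₀ := by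
  have hFz : ∀ᶠ t in 𝓝 t₀, DifferentiableAt ℝ F (z t) := by
    have h1 : ∀ᶠ y in 𝓝 (z t₀), DifferentiableAt ℝ F y := by
      rw [hz₀]
      exact ((hF.of_le (m := 1) (by simp)).eventually (by simp)).mono fun y hy =>
        hy.differentiableAt (by simp)
    exact hz.self_of_nhds.continuousAt.eventually h1
  have hone : ∀ᶠ t in 𝓝 t₀, gaussDeriv φ ξ F (z t) = l t * k' t := by
    filter_upwards [hFz, hz, hl, hk', hk.eventually_nhds] with t h1 h2 h3 h4 h5
    have h6 : HasDerivAt (fun τ => F (z τ)) (k' t) t := h4.congr_of_eventuallyEq h5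
    have h7 := dirDeriv_eq_of_hasDerivAt rfl h1 h2 h6
    simp only [dirDeriv] at h7
    rw [gaussDeriv, h3, map_smul, h7, smul_eq_mul]
  have hdiff : DifferentiableAt ℝ (gaussDeriv φ ξ F) (z t₀) := by
    rw [hz₀]
    exact ((hF.fderiv_right (m := ∞) (by simp)).clm_apply hG).differentiableAt (by simp)
  refine ⟨by simpa [hz₀] using hone.self_of_nhds, ?_⟩
  have h8 : HasDerivAt (fun τ => gaussDeriv φ ξ F (z τ))
      (deriv l t₀ * k' t₀ + l t₀ * k'') t₀ :=
    (hl'.hasDerivAt.mul hk'').congr_of_eventuallyEq hone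
  have h9 := dirDeriv_eq_of_hasDerivAt rfl hdiff hz.self_of_nhds h8
  simp only [dirDeriv] at h9
  change fderiv ℝ (gaussDeriv φ ξ F) x (gaussMap φ x ξ) = _
  have h10 := hl.self_of_nhds
  rw [hz₀] at h10 h9
  rw [h10, map_smul, h9, smul_eq_mul]
  ring

end Phase

/-! ### First and second derivatives of the Hermite phase -/

section Hermite

variable {d : ℕ}

/-- The open condition `𝒟 > 0`, `sin S_c > 0` under which the Hermite phase is smooth. -/
def HermiteRegular (x y : EuclideanSpace ℝ (Fin d)) : Prop :=
  0 < hermiteD x y ∧ 0 < Real.sin (hermiteS x y)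

/-- The initial momentum `p = (x - cos S_c y) / sin S_c` of the trajectory
`t ↦ cos t y + sin t p` going from `y` to `x` in time `S_c`. -/
def hermiteP (x y : EuclideanSpace ℝ (Fin d)) : EuclideanSpace ℝ (Fin d) :=
  (Real.sin (hermiteS x y))⁻¹ • (x - Real.cos (hermiteS x y) • y)

/-- The final momentum `q = (cos S_c x - y) / sin S_c` of the trajectory from `y` to `x`. -/
def hermiteQ (x y : EuclideanSpace ℝ (Fin d)) : EuclideanSpace ℝ (Fin d) :=
  (Real.sin (hermiteS x y))⁻¹ • (Real.cos (hermiteS x y) • x - y)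

theorem sin_hermiteS (x y : EuclideanSpace ℝ (Fin d)) :
    Real.sin (hermiteS x y) = √(1 - (inner ℝ x y + √(hermiteD x y)) ^ 2) :=
  Real.sin_arccos _

namespace HermiteRegular

variable {x y : EuclideanSpace ℝ (Fin d)}

theorem sq_lt_one (h : HermiteRegular x y) : (inner ℝ x y + √(hermiteD x y)) ^ 2 < 1 := by
  have h1 := h.2
  rw [sin_hermiteS, Real.sqrt_pos] at h1
  linarith

theorem cos_hermiteS (h : HermiteRegular x y) :
    Real.cos (hermiteS x y) = inner ℝ x y + √(hermiteD x y) := by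
  have h1 := (sq_lt_one_iff_abs_lt_one _).1 h.sq_lt_one
  rw [abs_lt] at h1
  exact Real.cos_arccos h1.1.le h1.2.le

theorem sqrt_eq (h : HermiteRegular x y) :
    √(hermiteD x y) = Real.cos (hermiteS x y) - inner ℝ x y := by
  rw [h.cos_hermiteS]; ring

theorem sqrt_pos (h : HermiteRegular x y) : 0 < √(hermiteD x y) := Real.sqrt_pos.2 h.1

/-- The time `S_c` is a critical point of the action. -/
theorem sin_sq (h : HermiteRegular x y) : Real.sin (hermiteS x y) ^ 2 =
    ‖x‖ ^ 2 + ‖y‖ ^ 2 - 2 * Real.cos (hermiteS x y) * inner ℝ x y := by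
  have h1 := Real.sq_sqrt h.1.le
  rw [h.sqrt_eq] at h1
  have h2 := Real.sin_sq_add_cos_sq (hermiteS x y)
  simp only [hermiteD] at h1
  linarith

theorem norm_sq_hermiteP (h : HermiteRegular x y) : ‖hermiteP x y‖ ^ 2 = 1 - ‖y‖ ^ 2 := by
  have hs := h.2.ne'
  have h1 := h.sin_sq
  have h2 := Real.sin_sq_add_cos_sq (hermiteS x y)
  rw [hermiteP, norm_smul, mul_pow, norm_sub_sq_real, inner_smul_right, norm_smul, mul_pow,
    Real.norm_eq_abs, Real.norm_eq_abs, sq_abs, sq_abs]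
  field_simp
  linear_combination ‖y‖ ^ 2 * h2 - h1

/-- At the critical time the square root of the discriminant is `⟨p, q⟩`. -/
theorem inner_hermiteP_hermiteQ (h : HermiteRegular x y) :
    inner ℝ (hermiteP x y) (hermiteQ x y) = √(hermiteD x y) := by
  have hs := h.2.ne'
  have h1 := h.sin_sq
  have h2 := Real.sin_sq_add_cos_sq (hermiteS x y)
  rw [h.sqrt_eq, hermiteP, hermiteQ]
  simp only [inner_sub_left, inner_sub_right, inner_smul_left, inner_smul_right,
    real_inner_self_eq_norm_sq, RCLike.conj_to_real]
  rw [real_inner_comm x y]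
  field_simp
  linear_combination -Real.cos (hermiteS x y) * h1 + inner ℝ x y * h2

theorem hermiteQ_eq (h : HermiteRegular x y) : hermiteQ x y =
    Real.cos (hermiteS x y) • hermiteP x y - Real.sin (hermiteS x y) • y := by
  have hs := h.2.ne'
  have h2 := Real.sin_sq_add_cos_sq (hermiteS x y)
  ext k
  simp only [hermiteP, hermiteQ, PiLp.sub_apply, PiLp.smul_apply, smul_eq_mul]
  field_simp
  linear_combination y k * h2

section Deriv

variable {X Y : ℝ → EuclideanSpace ℝ (Fin d)} {u w : EuclideanSpace ℝ (Fin d)} {t : ℝ}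

theorem hasDerivAt_hermiteS (h : HermiteRegular (X t) (Y t)) (hX : HasDerivAt X u t)
    (hY : HasDerivAt Y w t) :
    HasDerivAt (fun τ => hermiteS (X τ) (Y τ))
      ((inner ℝ (hermiteP (X t) (Y t)) u - inner ℝ (hermiteQ (X t) (Y t)) w) /
        √(hermiteD (X t) (Y t))) t := by
  have hB := hX.inner ℝ hY
  have hD := ((((hasDerivAt_const t (1 : ℝ)).fun_add (hB.fun_pow 2)).fun_sub hX.norm_sq).fun_sub hY.norm_sq)
  have hsq := hD.sqrt h.1.ne'
  have hlt := (sq_lt_one_iff_abs_lt_one _).1 h.sq_lt_one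
  rw [abs_lt] at hlt
  have hr := h.sqrt_pos.ne'
  have hs := h.2.ne'
  have := (Real.hasDerivAt_arccos hlt.1.ne' hlt.2.ne).comp t (hB.fun_add hsq)
  refine this.congr_deriv ?_
  rw [← sin_hermiteS]
  change -(1 / Real.sin (hermiteS (X t) (Y t))) * (_ + _ / (2 * √(hermiteD (X t) (Y t)))) = _
  have hq := h.sqrt_eq
  simp only [hermiteP, hermiteQ, inner_sub_left, inner_smul_left, RCLike.conj_to_real]
  field_simp
  rw [real_inner_comm u (Y t)]
  push_cast
  linear_combination (-2 * (inner ℝ (X t) w + inner ℝ u (Y t))) * hq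

theorem hasDerivAt_hermitePhase (h : HermiteRegular (X t) (Y t)) (hX : HasDerivAt X u t)
    (hY : HasDerivAt Y w t) :
    HasDerivAt (fun τ => hermitePhase (X τ) (Y τ))
      (inner ℝ (hermiteQ (X t) (Y t)) u - inner ℝ (hermiteP (X t) (Y t)) w) t := by
  have hS := hasDerivAt_hermiteS h hX hY
  have hB := hX.inner ℝ hY
  have hr := h.sqrt_pos.ne'
  have hs := h.2.ne'
  have hsin := h.sin_sq
  have hcs := Real.sin_sq_add_cos_sq (hermiteS (X t) (Y t))
  have := (hS.fun_add ((((hX.norm_sq.fun_add hY.norm_sq).fun_mul hS.cos).fun_sub (hB.const_mul 2)).fun_div hS.sin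
    hs)).const_mul (1 / 2)
  refine this.congr_deriv ?_
  generalize (inner ℝ (hermiteP (X t) (Y t)) u - inner ℝ (hermiteQ (X t) (Y t)) w) /
    √(hermiteD (X t) (Y t)) = S'
  simp only [hermiteP, hermiteQ, inner_sub_left, inner_smul_left, RCLike.conj_to_real]
  field_simp
  rw [real_inner_comm u (Y t)]
  linear_combination S' * hsin - S' * (‖X t‖ ^ 2 + ‖Y t‖ ^ 2) * hcs

theorem hasDerivAt_inner_hermiteP {x : EuclideanSpace ℝ (Fin d)} (h : HermiteRegular x (Y t))
    (hY : HasDerivAt Y w t) (v : EuclideanSpace ℝ (Fin d)) :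
    HasDerivAt (fun τ => inner ℝ (hermiteP x (Y τ)) v)
      (inner ℝ (hermiteQ x (Y t)) w * inner ℝ (hermiteQ x (Y t)) v /
          (Real.sin (hermiteS x (Y t)) * √(hermiteD x (Y t)))
        - Real.cos (hermiteS x (Y t)) / Real.sin (hermiteS x (Y t)) * inner ℝ w v) t := by
  have hS := hasDerivAt_hermiteS (X := fun _ => x) h (hasDerivAt_const t x) hY
  have hr := h.sqrt_pos.ne'
  have hs := h.2.ne'
  have hcs := Real.sin_sq_add_cos_sq (hermiteS x (Y t))
  have hf : (fun τ => inner ℝ (hermiteP x (Y τ)) v) = fun τ =>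
      (inner ℝ x v - Real.cos (hermiteS x (Y τ)) * inner ℝ (Y τ) v) /
        Real.sin (hermiteS x (Y τ)) := by
    ext τ
    simp only [hermiteP, inner_sub_left, inner_smul_left, RCLike.conj_to_real]
    ring
  rw [hf]
  have := (((hS.cos).fun_mul (hY.inner ℝ (hasDerivAt_const t v))).const_sub (inner ℝ x v)).fun_div
    hS.sin hs
  refine this.congr_deriv ?_
  have hv : inner ℝ (hermiteQ x (Y t)) v = (Real.sin (hermiteS x (Y t)))⁻¹ *
      (Real.cos (hermiteS x (Y t)) * inner ℝ x v - inner ℝ (Y t) v) := by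
    simp only [hermiteQ, inner_sub_left, inner_smul_left, RCLike.conj_to_real]
  rw [hv]
  generalize inner ℝ (hermiteQ x (Y t)) w = qw
  simp only [inner_zero_right]
  field_simp
  linear_combination (-qw * inner ℝ (Y t) v) * hcs

theorem hasDerivAt_inner_hermiteQ {x : EuclideanSpace ℝ (Fin d)} (h : HermiteRegular x (Y t))
    (hY : HasDerivAt Y w t) (v : EuclideanSpace ℝ (Fin d)) :
    HasDerivAt (fun τ => inner ℝ (hermiteQ x (Y τ)) v)
      (inner ℝ (hermiteQ x (Y t)) w * inner ℝ (hermiteP x (Y t)) v /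
          (Real.sin (hermiteS x (Y t)) * √(hermiteD x (Y t)))
        - inner ℝ w v / Real.sin (hermiteS x (Y t))) t := by
  have hS := hasDerivAt_hermiteS (X := fun _ => x) h (hasDerivAt_const t x) hY
  have hr := h.sqrt_pos.ne'
  have hs := h.2.ne'
  have hcs := Real.sin_sq_add_cos_sq (hermiteS x (Y t))
  have hf : (fun τ => inner ℝ (hermiteQ x (Y τ)) v) = fun τ =>
      (Real.cos (hermiteS x (Y τ)) * inner ℝ x v - inner ℝ (Y τ) v) /
        Real.sin (hermiteS x (Y τ)) := by
    ext τ
    simp only [hermiteQ, inner_sub_left, inner_smul_left, RCLike.conj_to_real]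
    ring
  rw [hf]
  have := (((hS.cos).mul_const (inner ℝ x v)).fun_sub (hY.inner ℝ (hasDerivAt_const t v))).fun_div
    hS.sin hs
  refine this.congr_deriv ?_
  have hv : inner ℝ (hermiteP x (Y t)) v = (Real.sin (hermiteS x (Y t)))⁻¹ *
      (inner ℝ x v - Real.cos (hermiteS x (Y t)) * inner ℝ (Y t) v) := by
    simp only [hermiteP, inner_sub_left, inner_smul_left, RCLike.conj_to_real]
  rw [hv]
  generalize inner ℝ (hermiteQ x (Y t)) w = qw
  simp only [inner_zero_right]
  field_simp
  linear_combination (qw * inner ℝ x v) * hcs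

end Deriv

theorem contDiffAt_hermitePhase (h : HermiteRegular x y) :
    ContDiffAt ℝ ∞ (fun p : EuclideanSpace ℝ (Fin d) × EuclideanSpace ℝ (Fin d) => hermitePhase p.1 p.2) (x, y) := by
  have hB : ContDiffAt ℝ ∞ (fun p : EuclideanSpace ℝ (Fin d) × EuclideanSpace ℝ (Fin d) => inner ℝ p.1 p.2) (x, y) :=
    contDiffAt_fst.inner ℝ contDiffAt_snd
  have hD : ContDiffAt ℝ ∞ (fun p : EuclideanSpace ℝ (Fin d) × EuclideanSpace ℝ (Fin d) => hermiteD p.1 p.2) (x, y) :=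
    ((contDiffAt_const.add (hB.pow 2)).sub (contDiffAt_fst.norm_sq ℝ)).sub
      (contDiffAt_snd.norm_sq ℝ)
  have hlt := (sq_lt_one_iff_abs_lt_one _).1 h.sq_lt_one
  rw [abs_lt] at hlt
  have hS : ContDiffAt ℝ ∞ (fun p : EuclideanSpace ℝ (Fin d) × EuclideanSpace ℝ (Fin d) => hermiteS p.1 p.2) (x, y) :=
    (Real.contDiffAt_arccos hlt.1.ne' hlt.2.ne).comp (x, y)
      (hB.add (hD.sqrt h.1.ne'))
  have hA := (contDiffAt_fst (p := (x, y)) (𝕜 := ℝ) (n := ∞)).norm_sq ℝ |>.add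
    (contDiffAt_snd.norm_sq ℝ)
  exact contDiffAt_const.mul (hS.add (((hA.mul hS.cos).sub (contDiffAt_const.mul hB)).div
    hS.sin h.2.ne'))

theorem isOpen_setOf :
    IsOpen {p : EuclideanSpace ℝ (Fin d) × EuclideanSpace ℝ (Fin d) | HermiteRegular p.1 p.2} := by
  have hD : Continuous fun p : EuclideanSpace ℝ (Fin d) × EuclideanSpace ℝ (Fin d) => hermiteD p.1 p.2 := by
    unfold hermiteD; fun_prop
  have hS : Continuous fun p : EuclideanSpace ℝ (Fin d) × EuclideanSpace ℝ (Fin d) => Real.sin (hermiteS p.1 p.2) := by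
    unfold hermiteS
    exact Real.continuous_sin.comp (Real.continuous_arccos.comp
      ((continuous_fst.inner continuous_snd).add hD.sqrt))
  exact (isOpen_lt continuous_const hD).inter (isOpen_lt continuous_const hS)

end HermiteRegular

/-! ### Trajectories of the harmonic oscillator -/

/-- Along the trajectory `t ↦ cos t y + sin t p` of energy `|p|² + |y|² = 1`, the critical time
is `t` and the initial momentum is `p`, as long as `t` lies in `(0, π)` and precedes the first
conjugate time. -/
theorem hermite_trajectory {y p : EuclideanSpace ℝ (Fin d)} {t : ℝ}
    (hp : ‖p‖ ^ 2 = 1 - ‖y‖ ^ 2) (ht0 : 0 < t)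
    (htpi : t < Real.pi)
    (hΔ : 0 < (1 - ‖y‖ ^ 2) * Real.cos t - inner ℝ p y * Real.sin t) :
    HermiteRegular (Real.cos t • y + Real.sin t • p) y ∧
    hermiteS (Real.cos t • y + Real.sin t • p) y = t ∧
    hermiteP (Real.cos t • y + Real.sin t • p) y = p ∧
    √(hermiteD (Real.cos t • y + Real.sin t • p) y) =
      (1 - ‖y‖ ^ 2) * Real.cos t - inner ℝ p y * Real.sin t := by
  set x := Real.cos t • y + Real.sin t • p with hx
  have hcs := Real.sin_sq_add_cos_sq t
  have hin : inner ℝ x y = Real.cos t * ‖y‖ ^ 2 + Real.sin t * inner ℝ p y := by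
    simp only [hx, inner_add_left, inner_smul_left, real_inner_self_eq_norm_sq,
      RCLike.conj_to_real]
  have hn : ‖x‖ ^ 2 = Real.cos t ^ 2 * ‖y‖ ^ 2 + Real.sin t ^ 2 * (1 - ‖y‖ ^ 2) +
      2 * Real.cos t * Real.sin t * inner ℝ p y := by
    rw [hx, norm_add_sq_real, norm_smul, norm_smul, mul_pow, mul_pow, hp, Real.norm_eq_abs,
      Real.norm_eq_abs, sq_abs, sq_abs, inner_smul_left, inner_smul_right,
      real_inner_comm y p, RCLike.conj_to_real]
    ring
  have hD : hermiteD x y = ((1 - ‖y‖ ^ 2) * Real.cos t - inner ℝ p y * Real.sin t) ^ 2 := by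
    rw [hermiteD, hin, hn]
    linear_combination (‖y‖ ^ 2 - 1) * hcs
  have hsq : √(hermiteD x y) = (1 - ‖y‖ ^ 2) * Real.cos t - inner ℝ p y * Real.sin t := by
    rw [hD, Real.sqrt_sq hΔ.le]
  have hS : hermiteS x y = t := by
    rw [hermiteS, hsq, hin, ← Real.arccos_cos ht0.le htpi.le]
    congr 1
    rw [Real.arccos_cos ht0.le htpi.le]
    ring
  have hs := Real.sin_pos_of_pos_of_lt_pi ht0 htpi
  refine ⟨⟨by rw [hD]; positivity, by rwa [hS]⟩, hS, ?_, hsq⟩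
  rw [hermiteP, hS, hx, add_sub_cancel_left, smul_smul, inv_mul_cancel₀ hs.ne', one_smul]

end Hermite

/-! ### The direction of the Gauss map -/

section GaussMap

variable {m : ℕ}

theorem sum_mul_det_cons_single (w : Fin (m + 1) → ℝ) (M : Fin m → Fin (m + 1) → ℝ) :
    ∑ k, w k * Matrix.det (Matrix.of
      (Fin.cons (fun l => if l = k then (1 : ℝ) else 0) M : Fin (m + 1) → Fin (m + 1) → ℝ)) =
    Matrix.det (Matrix.of (Fin.cons w M : Fin (m + 1) → Fin (m + 1) → ℝ)) := by
  rw [Matrix.det_succ_row_zero]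
  refine Finset.sum_congr rfl fun k _ => ?_
  rw [Matrix.det_succ_row_zero, Finset.sum_eq_single k]
  · have h : ∀ v : Fin (m + 1) → ℝ,
        (Matrix.of (Fin.cons v M : Fin (m + 1) → Fin (m + 1) → ℝ)).submatrix Fin.succ
          k.succAbove = Matrix.of fun i j => M i (k.succAbove j) := by
      intro v; ext i j; simp
    rw [h, h]
    simp only [Matrix.of_apply, Fin.cons_zero, if_true]
    ring
  · intro b _ hb
    simp [hb]
  · simp

/-- If the mixed derivatives are `κ (-e_i + a_i e_{m+1})` with `κ ≠ 0`, then `G₀` is a nonzero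
multiple of `(a, 1)` and `H1` holds. -/
theorem gaussMap_of_mixedDeriv
    {φ : EuclideanSpace ℝ (Fin (m + 1)) → EuclideanSpace ℝ (Fin m) → ℝ}
    {x : EuclideanSpace ℝ (Fin (m + 1))} {ξ : EuclideanSpace ℝ (Fin m)} {κ : ℝ} (hκ : κ ≠ 0)
    {a : Fin m → ℝ}
    (hcast : ∀ i j, mixedDeriv φ x ξ i (Fin.castSucc j) = -(κ * if i = j then 1 else 0))
    (hlast : ∀ i, mixedDeriv φ x ξ i (Fin.last m) = κ * a i) :
    (∀ i, gaussMap φ x ξ (Fin.castSucc i) = a i * gaussMap φ x ξ (Fin.last m)) ∧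
    gaussMap φ x ξ (Fin.last m) ≠ 0 ∧ ConditionH1 φ x ξ := by
  set M : Fin m → Fin (m + 1) → ℝ := fun i l => mixedDeriv φ x ξ i l with hM
  have hdet : gaussMap φ x ξ (Fin.last m) ≠ 0 := by
    change Matrix.det (Matrix.of (Fin.cons (fun l => if l = Fin.last m then (1 : ℝ) else 0) M :
      Fin (m + 1) → Fin (m + 1) → ℝ)) ≠ 0
    intro h0
    obtain ⟨v, hv, hv0⟩ := Matrix.exists_mulVec_eq_zero_iff.2 h0
    have hvl : v (Fin.last m) = 0 := by
      have := congrFun hv0 0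
      simpa [Matrix.mulVec, dotProduct] using this
    refine hv (funext fun k => ?_)
    refine Fin.lastCases hvl (fun i => ?_) k
    have := congrFun hv0 i.succ
    simp only [Matrix.mulVec, dotProduct, Matrix.of_apply, Fin.cons_succ,
      Fin.sum_univ_castSucc, hvl, hM, hcast, mul_zero, add_zero, Pi.zero_apply] at this
    simpa [hκ] using this
  refine ⟨fun i => ?_, hdet, ?_⟩
  · -- `G₀` is orthogonal to the `i`-th mixed derivative: the determinant has a repeated row.
    have h1 := sum_mul_det_cons_single (M i) M
    rw [Matrix.det_zero_of_row_eq (i := 0) (j := i.succ) (Fin.succ_ne_zero i).symm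
      (by ext l; simp)] at h1
    change ∑ k, M i k * gaussMap φ x ξ k = 0 at h1
    simp only [Fin.sum_univ_castSucc, hM, hcast, hlast] at h1
    simp only [mul_ite, mul_one, mul_zero, neg_mul, ite_mul, zero_mul, Finset.sum_neg_distrib,
      Finset.sum_ite_eq, Finset.mem_univ, if_true] at h1
    refine mul_left_cancel₀ hκ ?_
    linear_combination -h1
  · have hli := Matrix.linearIndependent_rows_of_det_ne_zero hdet
    have hM' : LinearIndependent ℝ (Matrix.of M).row :=
      hli.comp Fin.succ (Fin.succ_injective m)
    have := hM'.rank_matrix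
    rw [Fintype.card_fin] at this
    exact this

end GaussMap

/-! ### Derivatives of the reduced phase -/

section ReducedPhase

variable {m : ℕ}

/-- The embedding `ξ ↦ (ξ, 0)` of `ℝ^m` into `ℝ^(m+1)`. -/
def snocZero (m : ℕ) : EuclideanSpace ℝ (Fin m) →L[ℝ] EuclideanSpace ℝ (Fin (m + 1)) :=
  LinearMap.toContinuousLinearMap
    { toFun := fun ξ => WithLp.toLp 2 (Fin.snoc (α := fun _ => ℝ) (fun i => ξ i) 0)
      map_add' := fun ξ η => by
        ext k
        refine Fin.lastCases ?_ (fun i => ?_) k <;> simp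
      map_smul' := fun c ξ => by
        ext k
        refine Fin.lastCases ?_ (fun i => ?_) k <;> simp }

theorem snocZero_single (i : Fin m) :
    snocZero m (EuclideanSpace.single i 1) = EuclideanSpace.single (Fin.castSucc i) 1 := by
  ext k
  change (Fin.snoc (α := fun _ => ℝ) (fun j => EuclideanSpace.single i (1 : ℝ) j) 0 :
    Fin (m + 1) → ℝ) k = _
  refine Fin.lastCases ?_ (fun j => ?_) k
  · simp [Fin.castSucc_ne_last, eq_comm]
  · simp

variable {x₀ y₀ : EuclideanSpace ℝ (Fin (m + 1))} {ρ : ℝ}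
  {x : EuclideanSpace ℝ (Fin (m + 1))} {ξ : EuclideanSpace ℝ (Fin m)}

theorem reducedPhase_eq (x₀ y₀ : EuclideanSpace ℝ (Fin (m + 1))) (ρ : ℝ)
    (x : EuclideanSpace ℝ (Fin (m + 1))) (ξ : EuclideanSpace ℝ (Fin m)) :
    reducedPhase x₀ y₀ ρ 0 x ξ =
      ρ⁻¹ * hermitePhase (x₀ + ρ • x) (y₀ + ρ • snocZero m ξ) := rfl

theorem contDiffAt_reducedPhase
    (h : HermiteRegular (x₀ + ρ • x) (y₀ + ρ • snocZero m ξ)) :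
    ContDiffAt ℝ ∞ (fun p : EuclideanSpace ℝ (Fin (m + 1)) × EuclideanSpace ℝ (Fin m) =>
      reducedPhase x₀ y₀ ρ 0 p.1 p.2) (x, ξ) := by
  let f := fun p : EuclideanSpace ℝ (Fin (m + 1)) × EuclideanSpace ℝ (Fin m) =>
    (x₀ + ρ • p.1, y₀ + ρ • snocZero m p.2)
  have hf : ContDiffAt ℝ ∞ f (x, ξ) := by
    fun_prop
  have hg : ContDiffAt ℝ ∞ (fun p : EuclideanSpace ℝ (Fin (m + 1)) ×
      EuclideanSpace ℝ (Fin (m + 1)) => hermitePhase p.1 p.2) (f (x, ξ)) :=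
    HermiteRegular.contDiffAt_hermitePhase (x := (f (x, ξ)).1) (y := (f (x, ξ)).2) h
  have hgf := hg.comp (x, ξ) hf
  exact contDiffAt_const.mul hgf

theorem eventually_hermiteRegular
    (h : HermiteRegular (x₀ + ρ • x) (y₀ + ρ • snocZero m ξ)) :
    ∀ᶠ p : EuclideanSpace ℝ (Fin (m + 1)) × EuclideanSpace ℝ (Fin m) in 𝓝 (x, ξ),
      HermiteRegular (x₀ + ρ • p.1) (y₀ + ρ • snocZero m p.2) := by
  have hc : Continuous fun p : EuclideanSpace ℝ (Fin (m + 1)) × EuclideanSpace ℝ (Fin m) =>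
      (x₀ + ρ • p.1, y₀ + ρ • snocZero m p.2) := by
    fun_prop
  exact (HermiteRegular.isOpen_setOf.preimage hc).mem_nhds h

theorem eventually_contDiffAt_reducedPhase
    (h : HermiteRegular (x₀ + ρ • x) (y₀ + ρ • snocZero m ξ)) :
    ∀ᶠ p in 𝓝 (x, ξ), ContDiffAt ℝ ∞
      (fun p : EuclideanSpace ℝ (Fin (m + 1)) × EuclideanSpace ℝ (Fin m) =>
        reducedPhase x₀ y₀ ρ 0 p.1 p.2) p :=
  (eventually_hermiteRegular h).mono fun _ hp => contDiffAt_reducedPhase hp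

theorem hasDerivAt_snocZero_line (y₀ : EuclideanSpace ℝ (Fin (m + 1)))
    (ξ w : EuclideanSpace ℝ (Fin m)) (ρ : ℝ) :
    HasDerivAt (fun τ : ℝ => y₀ + ρ • snocZero m (ξ + τ • w)) (ρ • snocZero m w) 0 := by
  have hY : HasDerivAt (fun τ : ℝ => ξ + τ • w) w 0 := by
    simpa using ((hasDerivAt_id (0 : ℝ)).smul_const w).const_add ξ
  exact (((snocZero m).hasFDerivAt.comp_hasDerivAt 0 hY).fun_const_smul ρ).const_add y₀

theorem dirDeriv_reducedPhase (hρ : ρ ≠ 0)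
    (h : HermiteRegular (x₀ + ρ • x) (y₀ + ρ • snocZero m ξ))
    (u : EuclideanSpace ℝ (Fin (m + 1))) (w : EuclideanSpace ℝ (Fin m)) :
    dirDeriv (u, w) (fun p : EuclideanSpace ℝ (Fin (m + 1)) × EuclideanSpace ℝ (Fin m) =>
      reducedPhase x₀ y₀ ρ 0 p.1 p.2) (x, ξ) =
    inner ℝ (hermiteQ (x₀ + ρ • x) (y₀ + ρ • snocZero m ξ)) u -
      inner ℝ (hermiteP (x₀ + ρ • x) (y₀ + ρ • snocZero m ξ)) (snocZero m w) := by
  have hX : HasDerivAt (fun τ : ℝ => x + τ • u) u 0 := by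
    simpa using ((hasDerivAt_id (0 : ℝ)).smul_const u).const_add x
  have hY : HasDerivAt (fun τ : ℝ => ξ + τ • w) w 0 := by
    simpa using ((hasDerivAt_id (0 : ℝ)).smul_const w).const_add ξ
  refine dirDeriv_eq_of_hasDerivAt (γ := fun τ : ℝ => (x + τ • u, ξ + τ • w)) (t := 0)
    (by simp) ((contDiffAt_reducedPhase h).differentiableAt (by simp)) (hX.prodMk hY) ?_
  simp only [reducedPhase_eq]
  have hX' : HasDerivAt (fun τ : ℝ => x₀ + ρ • (x + τ • u)) (ρ • u) 0 :=
    (hX.fun_const_smul ρ).const_add x₀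
  have h0 : HermiteRegular (x₀ + ρ • (x + (0 : ℝ) • u))
      (y₀ + ρ • snocZero m (ξ + (0 : ℝ) • w)) := by simpa using h
  refine ((HermiteRegular.hasDerivAt_hermitePhase (X := fun τ : ℝ => x₀ + ρ • (x + τ • u))
    (Y := fun τ : ℝ => y₀ + ρ • snocZero m (ξ + τ • w)) h0 hX'
    (hasDerivAt_snocZero_line y₀ ξ w ρ)).const_mul ρ⁻¹).congr_deriv ?_
  simp only [zero_smul, add_zero, inner_smul_right]
  field_simp

/-- The second derivatives of the reduced phase with one derivative in `ξ`. -/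
theorem dirDeriv_dirDeriv_reducedPhase (hρ : ρ ≠ 0)
    (h : HermiteRegular (x₀ + ρ • x) (y₀ + ρ • snocZero m ξ))
    {p q : EuclideanSpace ℝ (Fin (m + 1))} {S r : ℝ}
    (hp : hermiteP (x₀ + ρ • x) (y₀ + ρ • snocZero m ξ) = p)
    (hq : hermiteQ (x₀ + ρ • x) (y₀ + ρ • snocZero m ξ) = q)
    (hS : hermiteS (x₀ + ρ • x) (y₀ + ρ • snocZero m ξ) = S)
    (hr : √(hermiteD (x₀ + ρ • x) (y₀ + ρ • snocZero m ξ)) = r)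
    (u : EuclideanSpace ℝ (Fin (m + 1))) (w w' : EuclideanSpace ℝ (Fin m)) :
    dirDeriv (0, w) (dirDeriv (u, w')
      (fun p : EuclideanSpace ℝ (Fin (m + 1)) × EuclideanSpace ℝ (Fin m) =>
      reducedPhase x₀ y₀ ρ 0 p.1 p.2)) (x, ξ) =
    ρ * (inner ℝ q (snocZero m w) * inner ℝ p u / (Real.sin S * r)
        - inner ℝ (snocZero m w) u / Real.sin S)
    - ρ * (inner ℝ q (snocZero m w) * inner ℝ q (snocZero m w') / (Real.sin S * r)
        - Real.cos S / Real.sin S * inner ℝ (snocZero m w) (snocZero m w')) := by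
  subst hp hq hS hr
  have hY : HasDerivAt (fun τ : ℝ => ξ + τ • w) w 0 := by
    simpa using ((hasDerivAt_id (0 : ℝ)).smul_const w).const_add ξ
  have hsm := (contDiffAt_reducedPhase h).dirDeriv (u, w')
  refine dirDeriv_eq_of_hasDerivAt (γ := fun τ : ℝ => (x, ξ + τ • w)) (t := 0)
    (by simp) (hsm.differentiableAt (by simp)) ((hasDerivAt_const _ x).prodMk hY) ?_
  have h0 : HermiteRegular (x₀ + ρ • x) (y₀ + ρ • snocZero m (ξ + (0 : ℝ) • w)) := by
    simpa using h
  have hline := hasDerivAt_snocZero_line y₀ ξ w ρ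
  have hev : ∀ᶠ τ : ℝ in 𝓝 0,
      HermiteRegular (x₀ + ρ • x) (y₀ + ρ • snocZero m (ξ + τ • w)) := by
    have hc : Continuous fun τ : ℝ => (x₀ + ρ • x, y₀ + ρ • snocZero m (ξ + τ • w)) := by
      fun_prop
    exact (HermiteRegular.isOpen_setOf.preimage hc).mem_nhds h0
  have hQ := HermiteRegular.hasDerivAt_inner_hermiteQ
    (Y := fun τ : ℝ => y₀ + ρ • snocZero m (ξ + τ • w)) h0 hline u
  have hP := HermiteRegular.hasDerivAt_inner_hermiteP
    (Y := fun τ : ℝ => y₀ + ρ • snocZero m (ξ + τ • w)) h0 hline (snocZero m w')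
  refine ((hQ.fun_sub hP).congr_of_eventuallyEq
    (hev.mono fun τ hτ => dirDeriv_reducedPhase hρ hτ u w')).congr_deriv ?_
  simp only [zero_smul, add_zero, inner_smul_right, inner_smul_left, RCLike.conj_to_real]
  ring

theorem mixedDeriv_reducedPhase (hρ : ρ ≠ 0)
    (h : HermiteRegular (x₀ + ρ • x) (y₀ + ρ • snocZero m ξ))
    {p q : EuclideanSpace ℝ (Fin (m + 1))} {S r : ℝ}
    (hp : hermiteP (x₀ + ρ • x) (y₀ + ρ • snocZero m ξ) = p)
    (hq : hermiteQ (x₀ + ρ • x) (y₀ + ρ • snocZero m ξ) = q)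
    (hS : hermiteS (x₀ + ρ • x) (y₀ + ρ • snocZero m ξ) = S)
    (hr : √(hermiteD (x₀ + ρ • x) (y₀ + ρ • snocZero m ξ)) = r) (i : Fin m)
    (k : Fin (m + 1)) :
    mixedDeriv (reducedPhase x₀ y₀ ρ 0) x ξ i k =
      ρ / Real.sin S * (q (Fin.castSucc i) * p k / r - if k = Fin.castSucc i then 1 else 0) := by
  rw [mixedDeriv_eq_dirDeriv (eventually_contDiffAt_reducedPhase h),
    dirDeriv_dirDeriv_reducedPhase hρ h hp hq hS hr]
  simp only [snocZero_single, map_zero, inner_zero_right, EuclideanSpace.inner_single_right,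
    PiLp.single_apply, RCLike.conj_to_real]
  ring

theorem hessianMatrix_reducedPhase (hρ : ρ ≠ 0)
    (h : HermiteRegular (x₀ + ρ • x) (y₀ + ρ • snocZero m ξ))
    {p q : EuclideanSpace ℝ (Fin (m + 1))} {S r : ℝ}
    (hp : hermiteP (x₀ + ρ • x) (y₀ + ρ • snocZero m ξ) = p)
    (hq : hermiteQ (x₀ + ρ • x) (y₀ + ρ • snocZero m ξ) = q)
    (hS : hermiteS (x₀ + ρ • x) (y₀ + ρ • snocZero m ξ) = S)
    (hr : √(hermiteD (x₀ + ρ • x) (y₀ + ρ • snocZero m ξ)) = r) (i j : Fin m) :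
    hessianMatrix (reducedPhase x₀ y₀ ρ 0 x) ξ i j =
      ρ * (Real.cos S / Real.sin S * (if i = j then 1 else 0) -
        q (Fin.castSucc i) * q (Fin.castSucc j) / (Real.sin S * r)) := by
  have h1 := hessianMatrix_eq_dirDeriv (eventually_contDiffAt_reducedPhase h) i j
  change hessianMatrix (reducedPhase x₀ y₀ ρ 0 x) ξ i j = _ at h1
  rw [h1, dirDeriv_dirDeriv_reducedPhase hρ h hp hq hS hr]
  simp only [snocZero_single, inner_zero_right, EuclideanSpace.inner_single_right,
    PiLp.single_apply, RCLike.conj_to_real, Fin.castSucc_inj, eq_comm (a := j)]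
  ring

end ReducedPhase

/-! ### The matrices `(G₀ · ∇_x)^k ∂²_{ξξ} φ` at the base point -/

section Base

variable {m : ℕ}

/-- Inside the unit ball, `sin S_c` vanishes only on the diagonal. -/
theorem hermiteRegular_of_ne {d : ℕ} {x y : EuclideanSpace ℝ (Fin d)} (hx : ‖x‖ < 1)
    (hy : ‖y‖ < 1) (hD : 0 < hermiteD x y) (hne : x ≠ y) : HermiteRegular x y := by
  refine ⟨hD, ?_⟩
  rw [sin_hermiteS, Real.sqrt_pos, sub_pos, sq_lt_one_iff_abs_lt_one, abs_lt]
  have hin : |inner ℝ x y| < 1 := (abs_real_inner_le_norm x y).trans_lt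
    (mul_lt_one_of_nonneg_of_lt_one_left (norm_nonneg x) hx hy.le)
  rw [abs_lt] at hin
  have hsub : 0 < ‖x - y‖ ^ 2 := by
    have := norm_pos_iff.2 (sub_ne_zero.2 hne)
    positivity
  rw [norm_sub_sq_real] at hsub
  constructor
  · linarith [Real.sqrt_nonneg (hermiteD x y)]
  · have : √(hermiteD x y) < 1 - inner ℝ x y := by
      rw [Real.sqrt_lt' (by linarith), hermiteD]
      linarith
    linarith

theorem posDef_smul_one_add_smul_vecMulVec {α b : ℝ} (hα : 0 < α) (hb : 0 ≤ b)
    (v : Fin m → ℝ) :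
    (α • (1 : Matrix (Fin m) (Fin m) ℝ) + b • Matrix.vecMulVec v v).PosDef := by
  refine Matrix.PosDef.add_posSemidef (Matrix.PosDef.one.smul hα) ?_
  exact (Matrix.posSemidef_vecMulVec_self_star v).smul hb

/-- A combination of the identity and of `v vᵀ` with a nonzero coefficient cannot vanish unless
`v = 0`, in dimension at least two. -/
theorem eq_zero_of_smul_one_add_smul_vecMulVec_eq_zero (hm : 2 ≤ m) {X Y : ℝ} {v : Fin m → ℝ}
    (h : X • (1 : Matrix (Fin m) (Fin m) ℝ) + Y • Matrix.vecMulVec v v = 0) :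
    X = 0 ∧ (Y ≠ 0 → v = 0) := by
  have hij : ∀ i j, X * (if i = j then 1 else 0) + Y * (v i * v j) = 0 := fun i j => by
    simpa [Matrix.vecMulVec_apply, Matrix.one_apply] using congrFun (congrFun h i) j
  have hX : X = 0 := by
    have h01 : (⟨0, by omega⟩ : Fin m) ≠ ⟨1, by omega⟩ := by simp
    have h0 := hij ⟨0, by omega⟩ ⟨0, by omega⟩
    have h1 := hij ⟨1, by omega⟩ ⟨1, by omega⟩
    have h2 := hij ⟨0, by omega⟩ ⟨1, by omega⟩
    rw [if_pos rfl] at h0 h1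
    rw [if_neg h01] at h2
    generalize v ⟨0, by omega⟩ = v0 at *
    generalize v ⟨1, by omega⟩ = v1 at *
    have : X ^ 2 = 0 := by
      linear_combination X * h0 - Y * v0 ^ 2 * h1 + Y * v0 * v1 * h2
    exact pow_eq_zero_iff (two_ne_zero) |>.1 this
  refine ⟨hX, fun hY => funext fun i => ?_⟩
  have h0 := hij i i
  rw [hX, zero_mul, zero_add] at h0
  simpa [hY] using h0

variable {x₀ y₀ p : EuclideanSpace ℝ (Fin (m + 1))} {ρ : ℝ}

/-- The first two derivatives of the Hessian `∂²_{ξξ} φ = ρ (cot t - (sin t / Δ(t)) y' y'ᵀ)` along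
the trajectory through the base point. Here `Δ(t) = ⟨p, q(t)⟩ = √𝒟`, and
`δ`, `v` are the entries of the identity and of `y' y'ᵀ`. -/
theorem hasDerivAt_cot_sub {a β v δ t : ℝ} (hs : Real.sin t ≠ 0)
    (hΔ : a * Real.cos t - β * Real.sin t ≠ 0) :
    HasDerivAt (fun t => ρ * (Real.cos t / Real.sin t * δ -
        Real.sin t / (a * Real.cos t - β * Real.sin t) * v))
      (ρ * (-(1 / Real.sin t ^ 2) * δ - a / (a * Real.cos t - β * Real.sin t) ^ 2 * v)) t ∧
    HasDerivAt (fun t => ρ * (-(1 / Real.sin t ^ 2) * δ -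
        a / (a * Real.cos t - β * Real.sin t) ^ 2 * v))
      (ρ * (2 * Real.cos t / Real.sin t ^ 3 * δ - 2 * a * (a * Real.sin t + β * Real.cos t) /
        (a * Real.cos t - β * Real.sin t) ^ 3 * v)) t := by
  have hcs := Real.sin_sq_add_cos_sq t
  have h1 := Real.hasDerivAt_sin t
  have h2 := Real.hasDerivAt_cos t
  have h3 := (h2.const_mul a).fun_sub (h1.const_mul β)
  constructor
  · have h4 : HasDerivAt (fun t => Real.cos t / Real.sin t) (-(1 / Real.sin t ^ 2)) t := by
      refine (h2.fun_div h1 hs).congr_deriv ?_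
      field_simp
      linear_combination -hcs
    have h5 : HasDerivAt (fun t => Real.sin t / (a * Real.cos t - β * Real.sin t))
        (a / (a * Real.cos t - β * Real.sin t) ^ 2) t := by
      refine (h1.fun_div h3 hΔ).congr_deriv ?_
      congr 1
      linear_combination a * hcs
    exact ((h4.mul_const δ).fun_sub (h5.mul_const v)).const_mul ρ
  · have h4 := ((hasDerivAt_const t (1 : ℝ)).fun_div (h1.fun_pow 2) (pow_ne_zero 2 hs)).fun_neg
    have h5 := (hasDerivAt_const t a).fun_div (h3.fun_pow 2) (pow_ne_zero 2 hΔ)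
    refine (((h4.mul_const δ).fun_sub (h5.mul_const v)).const_mul ρ).congr_deriv ?_
    push_cast
    field_simp
    ring

/-- When `p` points in the direction `e_{m+1}`, the Gauss map of the reduced phase is tangent to
the trajectory `t ↦ cos t y₀ + sin t p`, along which the Hessian is explicit. -/
theorem reducedPhase_on_trajectory {t : ℝ} (hρ : ρ ≠ 0) (hp : ‖p‖ ^ 2 = 1 - ‖y₀‖ ^ 2)
    (hpc : ∀ i, p (Fin.castSucc i) = 0) (ht0 : 0 < t)
    (htpi : t < Real.pi)
    (hΔ : 0 < (1 - ‖y₀‖ ^ 2) * Real.cos t - inner ℝ p y₀ * Real.sin t)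
    {z : EuclideanSpace ℝ (Fin (m + 1))} (hz : x₀ + ρ • z = Real.cos t • y₀ + Real.sin t • p) :
    HermiteRegular (x₀ + ρ • z) (y₀ + ρ • snocZero m 0) ∧
    ConditionH1 (reducedPhase x₀ y₀ ρ 0) z 0 ∧
    gaussMap (reducedPhase x₀ y₀ ρ 0) z 0 (Fin.last m) ≠ 0 ∧
    gaussMap (reducedPhase x₀ y₀ ρ 0) z 0 =
      (ρ * (gaussMap (reducedPhase x₀ y₀ ρ 0) z 0 (Fin.last m) * p (Fin.last m) /
        ((1 - ‖y₀‖ ^ 2) * Real.cos t - inner ℝ p y₀ * Real.sin t))) •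
          (ρ⁻¹ • (Real.cos t • p - Real.sin t • y₀)) ∧
    ∀ i j, hessianMatrix (reducedPhase x₀ y₀ ρ 0 z) 0 i j =
      ρ * (Real.cos t / Real.sin t * (1 : Matrix (Fin m) (Fin m) ℝ) i j -
        Real.sin t / ((1 - ‖y₀‖ ^ 2) * Real.cos t - inner ℝ p y₀ * Real.sin t) *
          (y₀ (Fin.castSucc i) * y₀ (Fin.castSucc j))) := by
  obtain ⟨hreg, hS, hP, hr⟩ := hermite_trajectory hp ht0 htpi hΔ
  have hQ := hreg.hermiteQ_eq
  rw [hS, hP] at hQ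
  have hs := Real.sin_pos_of_pos_of_lt_pi ht0 htpi
  set Δ := (1 - ‖y₀‖ ^ 2) * Real.cos t - inner ℝ p y₀ * Real.sin t with hΔdef
  have hy : y₀ + ρ • snocZero m 0 = y₀ := by simp
  rw [← hz] at hreg hS hP hr hQ
  have hpy : inner ℝ p y₀ = p (Fin.last m) * y₀ (Fin.last m) := by
    rw [PiLp.inner_apply, Fin.sum_univ_castSucc]
    simp [hpc, mul_comm]
  have hpp : 1 - ‖y₀‖ ^ 2 = p (Fin.last m) ^ 2 := by
    rw [← hp, EuclideanSpace.real_norm_sq_eq, Fin.sum_univ_castSucc]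
    simp [hpc]
  have hreg' : HermiteRegular (x₀ + ρ • z) (y₀ + ρ • snocZero m 0) := by rwa [hy]
  have hqc : ∀ i, (Real.cos t • p - Real.sin t • y₀) (Fin.castSucc i) =
      -(Real.sin t * y₀ (Fin.castSucc i)) := fun i => by simp [hpc]
  have hmix := mixedDeriv_reducedPhase hρ hreg' (by rw [hy, hP]) (by rw [hy, hQ])
    (by rw [hy, hS]) (by rw [hy, hr])
  have hκ : ρ / Real.sin t ≠ 0 := div_ne_zero hρ hs.ne'
  obtain ⟨hG, hG0, hH1⟩ := gaussMap_of_mixedDeriv (φ := reducedPhase x₀ y₀ ρ 0) (x := z) (ξ := 0)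
    hκ (a := fun i => (Real.cos t • p - Real.sin t • y₀) (Fin.castSucc i) *
      p (Fin.last m) / Δ)
    (fun i j => by rw [hmix]; simp [hpc, eq_comm])
    (fun i => by rw [hmix, if_neg (Fin.castSucc_ne_last i).symm]; simp)
  refine ⟨hreg', hH1, hG0, ?_, fun i j => ?_⟩
  · ext k
    rw [PiLp.smul_apply, PiLp.smul_apply, smul_eq_mul, smul_eq_mul]
    refine Fin.lastCases ?_ (fun i => ?_) k
    · have h1 : p (Fin.last m) * (Real.cos t • p - Real.sin t • y₀) (Fin.last m) = Δ := by
        rw [hΔdef, hpy, hpp]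
        simp only [PiLp.sub_apply, PiLp.smul_apply, smul_eq_mul]
        ring
      field_simp
      linear_combination -h1
    · rw [hG i]
      field_simp
  · rw [hessianMatrix_reducedPhase hρ hreg' (by rw [hy, hP]) (by rw [hy, hQ])
      (by rw [hy, hS]) (by rw [hy, hr]), hqc, hqc, Matrix.one_apply]
    field_simp

/-- Evaluation at the base point: with `y'` the first `m` coordinates of `y₀`, `a = |p|²`,
`β = ⟨p, y₀⟩` and `Δ = √𝒟`, the matrix `(G₀ · ∇_x) ∂²_{ξξ} φ` is a nonzero multiple of the
`t`-derivative of the Hessian along the trajectory, and `(G₀ · ∇_x)² ∂²_{ξξ} φ` is a nonzero multiple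
of the second `t`-derivative plus a multiple of `(G₀ · ∇_x) ∂²_{ξξ} φ`. The factor `ρ` of the Hessian
is absorbed into `l`. -/
theorem gaussDerivHessian_reducedPhase {S : ℝ} (hρ : ρ ≠ 0) (hp : ‖p‖ ^ 2 = 1 - ‖y₀‖ ^ 2)
    (hpc : ∀ i, p (Fin.castSucc i) = 0) (hpl : p (Fin.last m) ≠ 0) (hS0 : 0 < S)
    (hSpi : S < Real.pi)
    (hΔ : 0 < (1 - ‖y₀‖ ^ 2) * Real.cos S - inner ℝ p y₀ * Real.sin S)
    (hx₀ : x₀ = Real.cos S • y₀ + Real.sin S • p) :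
    ∃ l l' : ℝ, l ≠ 0 ∧
      gaussDerivHessian 1 (reducedPhase x₀ y₀ ρ 0) 0 0 =
        l • (-((1 / Real.sin S ^ 2) • (1 : Matrix (Fin m) (Fin m) ℝ) +
          ((1 - ‖y₀‖ ^ 2) / ((1 - ‖y₀‖ ^ 2) * Real.cos S - inner ℝ p y₀ * Real.sin S) ^ 2) •
            Matrix.vecMulVec (fun i => y₀ (Fin.castSucc i)) fun i => y₀ (Fin.castSucc i))) ∧
      gaussDerivHessian 2 (reducedPhase x₀ y₀ ρ 0) 0 0 =
        (l ^ 2 / ρ) • ((2 * Real.cos S / Real.sin S ^ 3) • (1 : Matrix (Fin m) (Fin m) ℝ) -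
          (2 * (1 - ‖y₀‖ ^ 2) * ((1 - ‖y₀‖ ^ 2) * Real.sin S + inner ℝ p y₀ * Real.cos S) /
            ((1 - ‖y₀‖ ^ 2) * Real.cos S - inner ℝ p y₀ * Real.sin S) ^ 3) •
            Matrix.vecMulVec (fun i => y₀ (Fin.castSucc i)) fun i => y₀ (Fin.castSucc i)) +
        l' • gaussDerivHessian 1 (reducedPhase x₀ y₀ ρ 0) 0 0 := by
  set a := 1 - ‖y₀‖ ^ 2 with ha
  set β := inner ℝ p y₀ with hβ
  set φ := reducedPhase x₀ y₀ ρ 0 with hφ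
  -- the trajectory in the rescaled variable `x`, passing through `0` at time `S`
  let z : ℝ → EuclideanSpace ℝ (Fin (m + 1)) := fun t =>
    ρ⁻¹ • (Real.cos t • y₀ + Real.sin t • p - x₀)
  have hzx : ∀ t, x₀ + ρ • z t = Real.cos t • y₀ + Real.sin t • p := fun t => by
    simp only [z, smul_smul, mul_inv_cancel₀ hρ, one_smul, add_sub_cancel]
  have hz0 : z S = 0 := by simp [z, hx₀]
  have hzd : ∀ t, HasDerivAt z (ρ⁻¹ • (Real.cos t • p - Real.sin t • y₀)) t := fun t => by
    have h1 := ((Real.hasDerivAt_cos t).smul_const y₀).fun_add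
      ((Real.hasDerivAt_sin t).smul_const p)
    refine ((h1.sub_const x₀).fun_const_smul ρ⁻¹).congr_deriv ?_
    rw [neg_smul, neg_add_eq_sub]
  have hev : ∀ᶠ t in 𝓝 S, 0 < t ∧ t < Real.pi ∧ 0 < a * Real.cos t - β * Real.sin t := by
    refine (lt_mem_nhds hS0).and ((gt_mem_nhds hSpi).and ?_)
    have hc : Continuous fun t => a * Real.cos t - β * Real.sin t := by fun_prop
    exact hc.continuousAt.eventually (lt_mem_nhds hΔ)
  have htraj := hev.mono fun t ht => reducedPhase_on_trajectory (x₀ := x₀) hρ hp hpc ht.1 ht.2.1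
    ht.2.2 (hzx t)
  have hbase := htraj.self_of_nhds
  rw [hz0] at hbase
  have hsm := eventually_contDiffAt_reducedPhase hbase.1
  have hG := contDiffAt_gaussMap hsm
  let L : ℝ → ℝ := fun t =>
    ρ * (gaussMap φ (z t) 0 (Fin.last m) * p (Fin.last m) / (a * Real.cos t - β * Real.sin t))
  have hL : DifferentiableAt ℝ L S := by
    have h1 : DifferentiableAt ℝ (fun t => gaussMap φ (z t) 0) S := by
      have h2 : DifferentiableAt ℝ (fun x => gaussMap φ x 0) (z S) := by
        rw [hz0]; exact hG.differentiableAt (by simp)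
      exact h2.comp S (hzd S).differentiableAt
    have h3 := differentiableAt_euclidean.1 h1 (Fin.last m)
    have h4 : DifferentiableAt ℝ (fun t => a * Real.cos t - β * Real.sin t) S := by fun_prop
    exact ((h3.mul_const _).div h4 hΔ.ne').const_mul ρ
  have hL0 : L S ≠ 0 := by
    simp only [L, hz0]
    exact mul_ne_zero hρ (div_ne_zero (mul_ne_zero hbase.2.2.1 hpl) hΔ.ne')
  have hs : ∀ t, 0 < t ∧ t < Real.pi ∧ 0 < a * Real.cos t - β * Real.sin t →
      Real.sin t ≠ 0 := fun t ht => (Real.sin_pos_of_pos_of_lt_pi ht.1 ht.2.1).ne'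
  have key : ∀ i j, _ := fun i j => gaussDeriv_along_curve (φ := φ) (ξ := 0) hz0
    (contDiffAt_hessianMatrix hsm i j) hG (Eventually.of_forall hzd)
    (l := L) (htraj.mono fun t ht => ht.2.2.2.1) hL
    (htraj.mono fun t ht => ht.2.2.2.2 i j)
    (hev.mono fun t ht => (hasDerivAt_cot_sub (hs t ht) ht.2.2.ne').1)
    (hasDerivAt_cot_sub (hs S hev.self_of_nhds) hΔ.ne').2
  have h1 : gaussDerivHessian 1 φ 0 0 =
        (L S * ρ) • (-((1 / Real.sin S ^ 2) • (1 : Matrix (Fin m) (Fin m) ℝ) +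
          (a / (a * Real.cos S - β * Real.sin S) ^ 2) •
            Matrix.vecMulVec (fun i => y₀ (Fin.castSucc i)) fun i => y₀ (Fin.castSucc i))) := by
    ext i j
    refine (key i j).1.trans ?_
    simp only [Matrix.smul_apply, Matrix.neg_apply, Matrix.add_apply, Matrix.vecMulVec_apply,
      smul_eq_mul]
    ring
  refine ⟨L S * ρ, deriv L S, mul_ne_zero hL0 hρ, h1, ?_⟩
  rw [h1]
  ext i j
  refine (key i j).2.trans ?_
  simp only [Matrix.smul_apply, Matrix.neg_apply, Matrix.add_apply, Matrix.sub_apply,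
    Matrix.vecMulVec_apply, smul_eq_mul]
  field_simp
  ring

end Base

end

/-! ### Failure of Bourgain's condition -/

theorem mainTheorem6 (m : ℕ) (hm : 2 ≤ m) :
    ∃ r : ℝ, 0 < r ∧
      ∀ c₀ : ℝ, 0 < c₀ → c₀ < 1 →
      ∀ x₀ y₀ : EuclideanSpace ℝ (Fin (m + 1)),
        (x₀, y₀) ∈ hermiteRegion (m + 1) c₀ → ‖x₀‖ < r → y₀ ≠ 0 →
        ‖hermiteB x₀ y₀‖⁻¹ • hermiteB x₀ y₀ = EuclideanSpace.single (Fin.last m) 1 →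
        ∀ ρ : ℝ, 0 < ρ →
          CarlesonSjolinAt (reducedPhase x₀ y₀ ρ 0) 0 0 ∧
          (BourgainConditionAt (reducedPhase x₀ y₀ ρ 0) 0 0 ↔ ∃ c : ℝ, x₀ = c • y₀) := by
  -- The region already forces `‖x₀‖ < 1`, and the argument holds on all of it.
  refine ⟨1, one_pos, fun c₀ hc0 hc1 x₀ y₀ hreg _ hy₀ hb ρ hρ => ?_⟩
  obtain ⟨hx, hy, hD⟩ := hreg
  have hxl : ‖x₀‖ < 1 := by simp only at hx; linarith
  have hyl : ‖y₀‖ < 1 := by simp only at hy; linarith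
  have hD0 : 0 < hermiteD x₀ y₀ := lt_trans (by positivity) hD
  have hb0 : hermiteB x₀ y₀ ≠ 0 := by
    intro h0
    rw [h0, smul_zero] at hb
    have := congrArg (fun v : EuclideanSpace ℝ (Fin (m + 1)) => v (Fin.last m)) hb
    simp at this
  have hne : x₀ ≠ y₀ := by
    rintro rfl
    apply hb0
    have h1 : hermiteD x₀ x₀ = (1 - ‖x₀‖ ^ 2) ^ 2 := by
      rw [hermiteD, real_inner_self_eq_norm_sq]; ring
    have h2 : hermiteS x₀ x₀ = 0 := by
      rw [hermiteS, h1, Real.sqrt_sq (by nlinarith [norm_nonneg x₀]),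
        real_inner_self_eq_norm_sq, add_sub_cancel, Real.arccos_one]
    rw [hermiteB, h2, Real.cos_zero, one_smul, sub_self]
  have h := hermiteRegular_of_ne hxl hyl hD0 hne
  set S := hermiteS x₀ y₀ with hS
  set p := hermiteP x₀ y₀ with hp
  have hs : 0 < Real.sin S := h.2
  have hS0 : 0 < S := lt_of_le_of_ne (Real.arccos_nonneg _) fun h0 => by
    rw [← h0, Real.sin_zero] at hs; exact lt_irrefl _ hs
  have hSpi : S < Real.pi := lt_of_le_of_ne (Real.arccos_le_pi _) fun h0 => by
    rw [h0, Real.sin_pi] at hs; exact lt_irrefl _ hs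
  have hpn := h.norm_sq_hermiteP
  have hbn : 0 < ‖hermiteB x₀ y₀‖ := norm_pos_iff.2 hb0
  have hbe : hermiteB x₀ y₀ = ‖hermiteB x₀ y₀‖ • EuclideanSpace.single (Fin.last m) 1 := by
    rw [← hb, smul_smul, mul_inv_cancel₀ hbn.ne', one_smul]
  have hpe : p = ((Real.sin S)⁻¹ * ‖hermiteB x₀ y₀‖) • EuclideanSpace.single (Fin.last m) 1 := by
    rw [mul_smul, ← hbe]; rfl
  have hpc : ∀ i, p (Fin.castSucc i) = 0 := fun i => by
    rw [hpe]; simp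
  have hpl : p (Fin.last m) ≠ 0 := by
    rw [hpe]; simp [hs.ne', hb0]
  have hx₀ : x₀ = Real.cos S • y₀ + Real.sin S • p := by
    rw [hp, hermiteP, ← hS, smul_smul, mul_inv_cancel₀ hs.ne', one_smul, add_sub_cancel]
  have hΔ : 0 < (1 - ‖y₀‖ ^ 2) * Real.cos S - inner ℝ p y₀ * Real.sin S := by
    have h1 := h.sqrt_pos
    rw [← h.inner_hermiteP_hermiteQ, h.hermiteQ_eq, inner_sub_right, inner_smul_right,
      inner_smul_right, real_inner_self_eq_norm_sq, hpn] at h1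
    linarith
  have ha : 0 < 1 - ‖y₀‖ ^ 2 := by nlinarith [norm_nonneg y₀]
  have hreg' : HermiteRegular (x₀ + ρ • (0 : EuclideanSpace ℝ (Fin (m + 1))))
      (y₀ + ρ • snocZero m 0) := by simpa using h
  have hsm := eventually_contDiffAt_reducedPhase hreg'
  obtain ⟨l, l', hl, h1, h2⟩ :=
    gaussDerivHessian_reducedPhase hρ.ne' hpn hpc hpl hS0 hSpi hΔ hx₀
  have hpos := posDef_smul_one_add_smul_vecMulVec (α := 1 / Real.sin S ^ 2)
    (b := (1 - ‖y₀‖ ^ 2) / ((1 - ‖y₀‖ ^ 2) * Real.cos S - inner ℝ p y₀ * Real.sin S) ^ 2)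
    (by positivity) (by positivity) (fun i : Fin m => y₀ (Fin.castSucc i))
  refine ⟨⟨hsm.self_of_nhds, ?_, ?_⟩, ?_⟩
  · exact (reducedPhase_on_trajectory hρ.ne' hpn hpc hS0 hSpi hΔ (z := 0)
      (by rw [smul_zero, add_zero]; exact hx₀)).2.1
  · rw [ConditionH2Plus, curvatureMatrix_eq_gaussDerivHessian hsm, h1]
    rcases lt_or_gt_of_ne hl with hl | hl
    · left
      rw [smul_neg, ← neg_smul]
      exact hpos.smul (neg_pos.2 hl)
    · right
      rw [smul_neg, neg_neg]
      exact hpos.smul hl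
  · -- Both sides say that the first `m` coordinates of `y₀` vanish.
    have hpar : (∃ c : ℝ, x₀ = c • y₀) ↔ (fun i : Fin m => y₀ (Fin.castSucc i)) = 0 := by
      constructor
      · rintro ⟨c, hc⟩
        have hbc : hermiteB x₀ y₀ = (c - Real.cos S) • y₀ := by
          rw [hermiteB, ← hS, sub_smul, ← hc]
        have hcne : c - Real.cos S ≠ 0 := fun h0 => hb0 (by rw [hbc, h0, zero_smul])
        funext i
        have h3 := congrArg (fun v : EuclideanSpace ℝ (Fin (m + 1)) => v (Fin.castSucc i))
          (hbc.symm.trans hbe)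
        simpa [hcne] using h3
      · intro h0
        have hyl0 : y₀ (Fin.last m) ≠ 0 := fun h3 => hy₀ (by
          ext k
          refine Fin.lastCases h3 (fun i => ?_) k
          exact congrFun h0 i)
        refine ⟨x₀ (Fin.last m) / y₀ (Fin.last m), ?_⟩
        ext k
        refine Fin.lastCases ?_ (fun i => ?_) k
        · simp [hyl0]
        · have h3 := congrFun h0 i
          simp only [Pi.zero_apply] at h3
          rw [hx₀]
          simp [h3, hpc]
    rw [hpar, BourgainConditionAt, h2, h1]
    set v : Fin m → ℝ := fun i => y₀ (Fin.castSucc i) with hv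
    set a := 1 - ‖y₀‖ ^ 2
    set β := inner ℝ p y₀
    set Δ := a * Real.cos S - β * Real.sin S with hΔdef
    constructor
    · rintro ⟨c, hc⟩
      have hzero : (l ^ 2 / ρ * (2 * Real.cos S / Real.sin S ^ 3) +
            (c - l') * l * (1 / Real.sin S ^ 2)) • (1 : Matrix (Fin m) (Fin m) ℝ) +
          (-(l ^ 2 / ρ * (2 * a * (a * Real.sin S + β * Real.cos S) / Δ ^ 3)) +
            (c - l') * l * (a / Δ ^ 2)) • Matrix.vecMulVec v v = 0 := by
        rw [← sub_eq_zero] at hc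
        rw [← hc]
        module
      obtain ⟨hX, hY⟩ := eq_zero_of_smul_one_add_smul_vecMulVec_eq_zero hm hzero
      refine hY fun hY0 => ?_
      -- Eliminating `c - l'` from the two coefficients leaves the determinant `2 a² / (s³ Δ³)`.
      have hdet : l ^ 2 / ρ * (2 * a ^ 2 / (Real.sin S ^ 3 * Δ ^ 3)) = 0 := by
        have h3 : 2 * Real.cos S / Real.sin S ^ 3 * (a / Δ ^ 2) +
            2 * a * (a * Real.sin S + β * Real.cos S) / Δ ^ 3 * (1 / Real.sin S ^ 2) =
            2 * a ^ 2 / (Real.sin S ^ 3 * Δ ^ 3) := by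
          field_simp
          rw [hΔdef]
          linear_combination a * Real.sin_sq_add_cos_sq S
        rw [← h3]
        linear_combination (a / Δ ^ 2) * hX - (1 / Real.sin S ^ 2) * hY0
      have : l ^ 2 / ρ * (2 * a ^ 2 / (Real.sin S ^ 3 * Δ ^ 3)) ≠ 0 := by positivity
      exact this hdet
    · intro hv0
      refine ⟨l' - l / ρ * (2 * Real.cos S / Real.sin S), ?_⟩
      rw [hv0, Matrix.zero_vecMulVec, smul_zero, smul_zero, sub_zero, add_zero]
      ext i j
      simp only [Matrix.smul_apply, Matrix.neg_apply, Matrix.add_apply, smul_eq_mul]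
      field_simp
      ring
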